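/- **Setting.** Let $G$ be a countable infinite discrete amenable group acting continuously on compact metric spaces $(X,d)$ and $(Y,\rho)$, and let $\pi\colon X\to Y$ be a factor map, i.e. a continuous surjection with $\pi(gx)=g\pi(x)$ for all $g\in G$, $x\in X$. Let $\{F_n\}$ be a sequence of non-empty finite subsets of $G$ that is - Følner: $|F_n\,\triangle\, gF_n|/|F_n|\to 0$ for every $g\in G$; - tempered: there is $C>0$ with $\bigl|\bigcup_{k<n}F_k^{-1}F_n\bigr|\le C|F_n|$ for all $n$; - such that $|F_n|/\log n\to\infty$. **Notation.** Let $f$ be a real-valued continuous function on one of the systems, written $(X,G)$ below (the same definitions apply to $(Y,G)$). For a non-empty finite set $A\subset G$ put $d_A(x,y)=\max_{g\in A}d(gx,gy)$, $\overline B_A(x,\epsilon)=\{y: d_A(x,y)\le\epsilon\}$ and $f_A(x)=\sum_{g\in A}f(gx)$. For a subset $Z$, $\epsilon>0$, $s\in\mathbb R$ and $N\in\mathbb N$ let $$M^P(N,s,\epsilon,Z,f)=\sup\sum_{i}e^{-s|F_{n_i}|+f_{F_{n_i}}(x_i)},$$ the supremum being over all finite or countable families $(n_i,x_i)_i$ with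 $n_i\ge N$, $x_i\in Z$ and the balls $\overline B_{F_{n_i}}(x_i,\epsilon)$ pairwise disjoint. Put $$M^P(s,\epsilon,Z,f)=\lim_{N\to\infty}M^P(N,s,\epsilon,Z,f),\qquad M^{\mathcal P}(s,\epsilon,Z,f)=\inf\Bigl\{\sum_{i=1}^\infty M^P(s,\epsilon,Z_i,f): Z\subset\bigcup_{i=1}^\infty Z_i\Bigr\}.$$ The *packing topological pressure* of $Z$ along $\{F_n\}$ is $$P^P(Z,f)=\lim_{\epsilon\to0}\ \sup\{s\in\mathbb R: M^{\mathcal P}(s,\epsilon,Z,f)=\infty\}\in[-\infty,\infty]$$ (with $\sup\emptyset=-\infty$, so that $P^P(\emptyset,f)=-\infty$). The *upper capacity topological entropy* of $Z$ along $\{F_n\}$ is $$h^{UC}_{top}(Z)=\lim_{\epsilon\to0}\limsup_{n\to\infty}\frac1{|F_n|}\log\sup\{\#D: D\subset Z,\ d_{F_n}(x,y)>\epsilon\text{ for all distinct }x,y\in D\}.$$ **Theorem 1.2.** For every subset $E\subset X$ and every continuous $f\colon Y\to\mathbb R$, $$P^P(\pi(E),f)\ \le\ P^P(E,f\circ\pi)\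 \le\ P^P(\pi(E),f)+\sup_{y\in Y}h^{UC}_{top}(\pi^{-1}(y)),$$ as inequalities in $[-\infty,\infty]$. (When $E=\emptyset$ both pressures, and the right-hand side, are $-\infty$.) -/

import Mathlib

open Filter Topology
open scoped ENNReal Pointwise

noncomputable section

namespace AmenablePressure

/-! ### Følner sequences and factor maps -/

open Classical in
/-- A Følner sequence of a discrete group `G`: non-empty finite sets `F n` with
`|F n ∆ g (F n)| / |F n| → 0` for every `g : G`. -/
structure IsFolnerSeq {G : Type*} [Group G] (F : ℕ → Finset G) : Prop where
  nonempty : ∀ n, (F n).Nonempty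
  tendsto_symmDiff : ∀ g : G,
    Tendsto (fun n => ((symmDiff (F n) (g • F n)).card : ℝ) / ((F n).card : ℝ)) atTop (𝓝 0)

open Classical in
/-- A sequence of finite sets is tempered if `|⋃_{k < n} (F k)⁻¹ (F n)| ≤ C |F n|` for all `n`,
with a constant `C > 0` independent of `n`. -/
def IsTempered {G : Type*} [Group G] (F : ℕ → Finset G) : Prop :=
  ∃ C : ℝ, 0 < C ∧ ∀ n,
    (((Finset.range n).biUnion fun k => (F k)⁻¹ * F n).card : ℝ) ≤ C * ((F n).card : ℝ)

/-- A factor map between `G`-systems: continuous, onto, and `G`-equivariant. -/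
structure IsFactorMap (G : Type*) {X Y : Type*} [TopologicalSpace X] [TopologicalSpace Y]
    [SMul G X] [SMul G Y] (π : X → Y) : Prop where
  continuous : Continuous π
  surjective : Function.Surjective π
  map_smul : ∀ (g : G) (x : X), π (g • x) = g • π x

/-! ### Bowen metrics, closed Bowen balls, orbit sums -/

/-- The Bowen metric `d_A(x, y) = max_{g ∈ A} d(g x, g y)` of a finite set `A` of `G`. -/
def bowenDist {G X : Type*} [MetricSpace X] [SMul G X] (A : Finset G) (x y : X) : ℝ :=
  ((A.sup fun g => nndist (g • x) (g • y) : NNReal) : ℝ)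

/-- The closed Bowen ball of radius `ε` around `x`. -/
def bowenClosedBall {G X : Type*} [MetricSpace X] [SMul G X] (A : Finset G) (x : X) (ε : ℝ) :
    Set X :=
  {y | bowenDist A x y ≤ ε}

/-- `f_A(x) = ∑_{g ∈ A} f (g x)`. -/
def orbitSum {G X : Type*} [SMul G X] (A : Finset G) (f : X → ℝ) (x : X) : ℝ :=
  ∑ g ∈ A, f (g • x)

theorem bowenDist_le_iff {G X : Type*} [MetricSpace X] [SMul G X] (A : Finset G) (x y : X)
    {ε : ℝ} (hε : 0 ≤ ε) : bowenDist A x y ≤ ε ↔ ∀ g ∈ A, dist (g • x) (g • y) ≤ ε := by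
  lift ε to NNReal using hε
  simp only [bowenDist, NNReal.coe_le_coe, Finset.sup_le_iff]
  rfl

/-! ### Packing topological pressure -/

/-- A finite or countable family of pairs `(n_i, x_i)` with `n_i ≥ N` and `x_i ∈ Z` whose closed
Bowen balls of radius `ε` for `F (n_i)` around `x_i` are pairwise disjoint. (For `ε > 0` such balls
are non-empty, so a disjoint indexed family is the same thing as a set of pairs.) -/
structure IsPacking {G X : Type*} [MetricSpace X] [SMul G X] (F : ℕ → Finset G) (N : ℕ) (ε : ℝ)
    (Z : Set X) (S : Set (ℕ × X)) : Prop where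
  countable : S.Countable
  le_index : ∀ p ∈ S, N ≤ p.1
  center_mem : ∀ p ∈ S, p.2 ∈ Z
  disjoint : S.PairwiseDisjoint fun p => bowenClosedBall (F p.1) p.2 ε

/-- `M^P(N, s, ε, Z, F, f)`: the supremum of `∑ exp (-s |F_{n_i}| + f_{F_{n_i}}(x_i))` over all
packings. -/
def packingPre {G X : Type*} [MetricSpace X] [SMul G X] (F : ℕ → Finset G) (f : X → ℝ)
    (N : ℕ) (s ε : ℝ) (Z : Set X) : ℝ≥0∞ :=
  ⨆ (S : Set (ℕ × X)) (_ : IsPacking F N ε Z S),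
    ∑' p : S, ENNReal.ofReal
      (Real.exp (-s * ((F p.1.1).card : ℝ) + orbitSum (F p.1.1) f p.1.2))

/-- `M^P(s, ε, Z, F, f)`: the limit of the non-increasing sequence `N ↦ M^P(N, s, ε, Z, F, f)`,
that is, its infimum. -/
def packingLim {G X : Type*} [MetricSpace X] [SMul G X] (F : ℕ → Finset G) (f : X → ℝ)
    (s ε : ℝ) (Z : Set X) : ℝ≥0∞ :=
  ⨅ N : ℕ, packingPre F f N s ε Z

/-- `M^𝒫(s, ε, Z, F, f)`: the infimum of `∑ M^P(s, ε, Z_i, F, f)` over countable covers of `Z`. -/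
def packingOuter {G X : Type*} [MetricSpace X] [SMul G X] (F : ℕ → Finset G) (f : X → ℝ)
    (s ε : ℝ) (Z : Set X) : ℝ≥0∞ :=
  ⨅ (W : ℕ → Set X) (_ : Z ⊆ ⋃ i, W i), ∑' i, packingLim F f s ε (W i)

/-- `P^P(ε, Z, F, f) = sup {s ∈ ℝ : M^𝒫(s, ε, Z, F, f) = ∞}`, an extended real. -/
def packingPressureAt {G X : Type*} [MetricSpace X] [SMul G X] (F : ℕ → Finset G) (f : X → ℝ)
    (ε : ℝ) (Z : Set X) : EReal :=
  ⨆ (s : ℝ) (_ : packingOuter F f s ε Z = ∞), (s : EReal)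

/-- The packing topological pressure `P^P(Z, F, f)`: the limit of `P^P(ε, Z, F, f)` as `ε ↓ 0`,
which is the supremum over `ε > 0`, see `tendsto_packingPressureAt`. -/
def packingPressure {G X : Type*} [MetricSpace X] [SMul G X] (F : ℕ → Finset G) (f : X → ℝ)
    (Z : Set X) : EReal :=
  ⨆ (ε : ℝ) (_ : 0 < ε), packingPressureAt F f ε Z

/-! ### Upper capacity topological pressure and entropy -/

/-- `E` is an `(A, ε)`-separated set of `Z`. -/
def IsSeparatedIn {G X : Type*} [MetricSpace X] [SMul G X] (A : Finset G) (ε : ℝ)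
    (Z E : Set X) : Prop :=
  E ⊆ Z ∧ ∀ x ∈ E, ∀ y ∈ E, x ≠ y → ε < bowenDist A x y

/-- `P(Z, ε, A, f)`: the supremum of `∑_{x ∈ E} exp (f_A(x))` over `(A, ε)`-separated sets `E`
of `Z`. -/
def separatedSum {G X : Type*} [MetricSpace X] [SMul G X] (A : Finset G) (f : X → ℝ)
    (ε : ℝ) (Z : Set X) : ℝ≥0∞ :=
  ⨆ (E : Set X) (_ : IsSeparatedIn A ε Z E),
    ∑' x : E, ENNReal.ofReal (Real.exp (orbitSum A f x.1))

/-- `P^{UC}(Z, ε, F, f) = limsup_n (1 / |F n|) log P(Z, ε, F n, f)`, an extended real. -/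
def ucPressureAt {G X : Type*} [MetricSpace X] [SMul G X] (F : ℕ → Finset G) (f : X → ℝ)
    (ε : ℝ) (Z : Set X) : EReal :=
  limsup (fun n => ENNReal.log (separatedSum (F n) f ε Z) / ((F n).card : EReal)) atTop

/-- The upper capacity topological pressure `P^{UC}(Z, F, f)`: the limit of `P^{UC}(Z, ε, F, f)` as
`ε ↓ 0`, which is the supremum over `ε > 0`, see `tendsto_ucPressureAt`. -/
def ucPressure {G X : Type*} [MetricSpace X] [SMul G X] (F : ℕ → Finset G) (f : X → ℝ)
    (Z : Set X) : EReal :=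
  ⨆ (ε : ℝ) (_ : 0 < ε), ucPressureAt F f ε Z

/-- The upper capacity topological entropy `h^{UC}_top(Z, F) = P^{UC}(Z, F, 0)`. -/
def ucEntropy {G X : Type*} [MetricSpace X] [SMul G X] (F : ℕ → Finset G) (Z : Set X) : EReal :=
  ucPressure F (fun _ => 0) Z

/-! ### The suprema and infima above are the limits they stand for -/

theorem packingPre_antitone {G X : Type*} [MetricSpace X] [SMul G X] (F : ℕ → Finset G)
    (f : X → ℝ) (s ε : ℝ) (Z : Set X) : Antitone fun N => packingPre F f N s ε Z := by
  intro N M hNM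
  exact iSup₂_le fun S hS => le_iSup₂_of_le S
    ⟨hS.countable, fun p hp => hNM.trans (hS.le_index p hp), hS.center_mem, hS.disjoint⟩ le_rfl

theorem tendsto_packingPre {G X : Type*} [MetricSpace X] [SMul G X] (F : ℕ → Finset G)
    (f : X → ℝ) (s ε : ℝ) (Z : Set X) :
    Tendsto (fun N => packingPre F f N s ε Z) atTop (𝓝 (packingLim F f s ε Z)) :=
  tendsto_atTop_iInf (packingPre_antitone F f s ε Z)

theorem packingPressureAt_antitone {G X : Type*} [MetricSpace X] [SMul G X] (F : ℕ → Finset G)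
    (f : X → ℝ) (Z : Set X) : Antitone fun ε => packingPressureAt F f ε Z := by
  intro ε δ h
  refine iSup₂_le fun s hs => le_iSup₂_of_le s ?_ le_rfl
  refine top_le_iff.1 (hs ▸ ?_)
  refine iInf₂_mono fun W _ => ENNReal.tsum_le_tsum fun i => iInf_mono fun N => ?_
  exact iSup₂_le fun S hS => le_iSup₂_of_le S
    ⟨hS.countable, hS.le_index, hS.center_mem,
      hS.disjoint.mono fun p y (hy : _ ≤ ε) => le_trans hy h⟩ le_rfl

theorem ucPressureAt_antitone {G X : Type*} [MetricSpace X] [SMul G X] (F : ℕ → Finset G)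
    (f : X → ℝ) (Z : Set X) : Antitone fun ε => ucPressureAt F f ε Z := by
  intro ε δ h
  refine limsup_le_limsup (Eventually.of_forall fun n => ?_)
  refine EReal.div_le_div_right_of_nonneg (by positivity) (ENNReal.log_monotone ?_)
  exact iSup₂_le fun E hE => le_iSup₂_of_le E
    ⟨hE.1, fun x hx y hy hxy => h.trans_lt (hE.2 x hx y hy hxy)⟩ le_rfl

theorem tendsto_iSup_pos {u : ℝ → EReal} (hu : Antitone u) :
    Tendsto u (𝓝[>] 0) (𝓝 (⨆ (ε : ℝ) (_ : 0 < ε), u ε)) := by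
  have h := hu.tendsto_nhdsGT 0
  rwa [sSup_image] at h

theorem tendsto_packingPressureAt {G X : Type*} [MetricSpace X] [SMul G X] (F : ℕ → Finset G)
    (f : X → ℝ) (Z : Set X) :
    Tendsto (fun ε => packingPressureAt F f ε Z) (𝓝[>] 0) (𝓝 (packingPressure F f Z)) :=
  tendsto_iSup_pos (packingPressureAt_antitone F f Z)

theorem tendsto_ucPressureAt {G X : Type*} [MetricSpace X] [SMul G X] (F : ℕ → Finset G)
    (f : X → ℝ) (Z : Set X) :
    Tendsto (fun ε => ucPressureAt F f ε Z) (𝓝[>] 0) (𝓝 (ucPressure F f Z)) :=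
  tendsto_iSup_pos (ucPressureAt_antitone F f Z)

end AmenablePressure

end

/-!
The left inequality is soft: `π` is uniformly continuous, so a disjoint family of Bowen balls in `Y`
lifts, centre by centre, to a disjoint family of smaller Bowen balls in `X` with the same weights.

The right inequality rests on a uniform form of Bowen's fibre estimate
(`exists_eventually_card_separated_le`): if every fibre has upper capacity entropy at most `a`, then
for all large `n` the preimage of *every* `δ`-Bowen ball of `F n` in `Y` has `(F n, ε)`-separated
sets of size at most `exp ((a + τ) |F n|)`. Given this, consider the points of index `n` in a packing
upstairs. They are separated, so a Vitali selection of disjoint `δ`-balls around their images keeps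
the weights up to a factor `exp ((a + 2 τ) |F n|)` (`exists_disjoint_tsum_le`). Lowering the exponent
`s` to `s - (a + 3 τ)` pays for this factor and leaves `exp (-τ |F n|)`, which is summable over `n`
because `|F n| / log n → ∞`. Hence an infinite packing measure upstairs at `s` forces an infinite one
downstairs at `s - (a + 3 τ)`.

The fibre estimate is proved by a quasi-tiling argument, which uses the Følner property alone. Pass
to a subsequence `F (κ j)` in which each set is much more invariant than the earlier ones, with
summable defects. The shape `F (κ j)` is admissible at `y` if the preimage of a small ball around `y`
is spanned, for the Bowen metric of `F (κ j)`, by about `exp (a |F (κ j)|)` points. By hypothesis a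
given `y` admits all but finitely many shapes, so by compactness there are, for each `m`, finitely
many shapes of which every `y` admits at least `m` (`exists_forall_le_card_fewSpanning`). Lay almost
disjoint translates of these shapes greedily in `F n`, from the largest to the smallest, the
translate by `c` only if the shape is admissible at `c • y` (`exists_quasiTiling`). An uncovered
position had `m` chances of being covered, and at each level the positions that failed are at most a
constant times the newly covered part; as the newly covered parts are disjoint, at most a proportion
`O(1 / m)` of `F n` stays uncovered. Coding a point over the Bowen ball by the spanning points of the
tiles, and by a fixed finite net of `X` on the uncovered positions, gives the estimate.
-/

noncomputable section

namespace AmenablePressure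

/-! ### Quasi-tilings of finite subsets of a group -/

section Tiling

variable {G : Type*} [Group G] [DecidableEq G]

/-- Greedy step: translates of one shape `S` are added to the region `D` already covered. Each new
tile `S c` has at least `(1 - θ) |S|` points of its own, and by maximality every candidate `c ∈ C`
has at least `θ |S|` points of `S c` covered in the end. -/
theorem exists_almost_disjoint_translates (S D C : Finset G) {θ : ℝ} (hθ : θ ≤ 1) :
    ∃ T ⊆ C, (1 - θ) * (S.card * T.card) ≤ ((D ∪ S * T).card : ℝ) - D.card ∧
      ∀ c ∈ C, θ * S.card ≤ (((S * {c}) ∩ (D ∪ S * T)).card : ℝ) := by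
  set P : Finset G → Prop := fun T =>
    T ⊆ C ∧ (1 - θ) * (S.card * T.card) ≤ ((D ∪ S * T).card : ℝ) - D.card
  have hfin : {T | P T}.Finite := C.powerset.finite_toSet.subset fun T hT => by
    simpa using hT.1
  obtain ⟨T, hT⟩ := hfin.exists_maximal ⟨∅, by simp [P]⟩
  refine ⟨T, hT.prop.1, hT.prop.2, fun c hc => ?_⟩
  by_contra! hlt
  have hcT : c ∉ T := by
    intro hcT
    have hsub : S * {c} ⊆ D ∪ S * T :=
      (Finset.mul_subset_mul_left (by simpa using hcT)).trans Finset.subset_union_right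
    rw [Finset.inter_eq_left.2 hsub, Finset.card_mul_singleton] at hlt
    nlinarith [(Nat.cast_nonneg S.card : (0 : ℝ) ≤ S.card)]
  have hunion : D ∪ S * insert c T = (D ∪ S * T) ∪ S * {c} := by
    rw [Finset.insert_eq, Finset.mul_union, Finset.union_comm (S * ({c} : Finset G)),
      Finset.union_assoc]
  have hcard : ((D ∪ S * insert c T).card : ℝ) + ((S * {c}) ∩ (D ∪ S * T)).card
      = (D ∪ S * T).card + S.card := by
    have := Finset.card_union_add_card_inter (D ∪ S * T) (S * {c})
    rw [hunion, Finset.inter_comm (S * ({c} : Finset G))]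
    rw [Finset.card_mul_singleton] at this
    exact_mod_cast this
  have hP : P (insert c T) := by
    refine ⟨Finset.insert_subset hc hT.prop.1, ?_⟩
    have h2 := hT.prop.2
    rw [Finset.card_insert_of_notMem hcT]
    push_cast
    nlinarith
  exact hcT (hT.le_of_ge hP (Finset.subset_insert c T) (Finset.mem_insert_self c T))

/-- Double counting: a point of `N` lies in at most `|S|` of the translates `S c`. -/
theorem card_mul_card_le_of_inter_translates (S N P : Finset G) {θ : ℝ} (hS : S.Nonempty)
    (h : ∀ c ∈ P, θ * S.card ≤ (((S * {c}) ∩ N).card : ℝ)) :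
    θ * P.card ≤ N.card := by
  have hle : ∑ c ∈ P, ((S * {c}) ∩ N).card ≤ S.card * N.card := by
    have h1 : ∀ c, ((S * {c}) ∩ N).card = (N.filter fun g => g ∈ S * {c}).card := by
      intro c
      rw [Finset.inter_comm, Finset.filter_mem_eq_inter]
    simp only [h1, Finset.card_filter]
    rw [Finset.sum_comm, mul_comm, ← smul_eq_mul]
    refine Finset.sum_le_card_nsmul _ _ _ fun g _ => ?_
    rw [← Finset.card_filter]
    refine Finset.card_le_card_of_injOn (fun c => g * c⁻¹) ?_ ?_
    · intro c hc
      simp only [Finset.coe_filter, Set.mem_ofPred_eq, Finset.mem_mul, Finset.mem_singleton] at hc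
      obtain ⟨_, s, hs, _, rfl, rfl⟩ := hc
      simpa using hs
    · intro c _ c' _ hcc
      simpa using hcc
  have hsum : ∑ c ∈ P, θ * (S.card : ℝ) ≤ S.card * N.card := by
    refine (Finset.sum_le_sum h).trans ?_
    exact_mod_cast hle
  have hpos : (0 : ℝ) < S.card := by exact_mod_cast hS.card_pos
  rw [Finset.sum_const, nsmul_eq_mul] at hsum
  exact le_of_mul_le_mul_left (by linarith) hpos

theorem card_boundary_translates_le (S S' T : Finset G) :
    ((S⁻¹ * (S' * T)) \ (S' * T)).card ≤ T.card * ((S⁻¹ * S') \ S').card := by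
  have hsub : (S⁻¹ * (S' * T)) \ (S' * T) ⊆ ((S⁻¹ * S') \ S') * T := by
    intro g hg
    rw [Finset.mem_sdiff, ← mul_assoc, Finset.mem_mul] at hg
    obtain ⟨⟨u, hu, t, ht, rfl⟩, hg⟩ := hg
    refine Finset.mul_mem_mul (Finset.mem_sdiff.2 ⟨hu, fun hu' => hg ?_⟩) ht
    exact Finset.mul_mem_mul hu' ht
  refine (Finset.card_le_card hsub).trans (Finset.card_mul_le.trans (le_of_eq (mul_comm _ _)))

/-- The candidates `c ∈ C` left in the uncovered set `R` are bounded by the newly covered part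
`D' \ D`. A translate `S c` with `c ∉ D` that meets `D` may owe its covered points to the earlier
tiles; such `c` lie in the boundary `(S⁻¹ * D) \ D`. -/
theorem card_uncovered_le_card_new (S D D' R C : Finset G) {θ : ℝ} (hS : S.Nonempty)
    (hDD' : D ⊆ D') (hRD : Disjoint R D)
    (hC : ∀ c ∈ C, θ * S.card ≤ (((S * {c}) ∩ D').card : ℝ)) (hθ : 0 ≤ θ) :
    θ * (R ∩ C).card ≤ ((D'.card : ℝ) - D.card) + θ * ((S⁻¹ * D) \ D).card := by
  have h := card_mul_card_le_of_inter_translates S (D' \ D) ((R ∩ C) \ ((S⁻¹ * D) \ D))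
    (θ := θ) hS (by
      intro c hc
      simp only [Finset.mem_sdiff, Finset.mem_inter, not_and, not_not] at hc
      obtain ⟨⟨hcR, hcC⟩, hcB⟩ := hc
      have hcD : c ∉ D := Finset.disjoint_left.1 hRD hcR
      refine (hC c hcC).trans ?_
      have : (S * {c}) ∩ D' ⊆ (S * {c}) ∩ (D' \ D) := by
        intro g hg
        rw [Finset.mem_inter] at hg
        refine Finset.mem_inter.2 ⟨hg.1, Finset.mem_sdiff.2 ⟨hg.2, fun hgD => hcD (hcB ?_)⟩⟩
        obtain ⟨s, hs, c', hc', rfl⟩ := Finset.mem_mul.1 hg.1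
        rw [Finset.mem_singleton] at hc'
        subst hc'
        exact Finset.mem_mul.2 ⟨s⁻¹, Finset.inv_mem_inv hs, _, hgD, by simp⟩
      exact_mod_cast Finset.card_le_card this)
  have h1 : ((R ∩ C).card : ℝ) ≤
      ((R ∩ C) \ ((S⁻¹ * D) \ D)).card + ((S⁻¹ * D) \ D).card := by
    exact_mod_cast Finset.card_le_card_sdiff_add_card
  have h2 : ((D' \ D).card : ℝ) = (D'.card : ℝ) - D.card := by
    rw [Finset.card_sdiff_of_subset hDD', Nat.cast_sub (Finset.card_le_card hDD')]
  rw [h2] at h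
  nlinarith

/-- Almost disjoint tiles `S i * c`, `c ∈ T i`, in `A`. The shapes are used in the order
`S 0, S 1, …`, earlier shapes being almost invariant under the later ones with defects `η`. The last
inequality bounds the uncovered positions, counted with the number of levels at which they were
candidates, by a multiple of `|A|` that does not depend on the number `L` of shapes. -/
theorem exists_quasiTiling (A : Finset G) (L : ℕ) (S C : ℕ → Finset G) (η : ℕ → ℝ)
    {θ : ℝ} (hθ0 : 0 < θ) (hθ1 : θ ≤ 1 / 2) (hS : ∀ i, (S i).Nonempty)
    (hCA : ∀ i, S i * C i ⊆ A)
    (hη : ∑ i ∈ Finset.range L, η i ≤ 1)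
    (hinv : ∀ i < L, ∀ i' < i, (((S i)⁻¹ * S i') \ S i').card ≤ η i * ((S i').card : ℝ))
    (hη0 : ∀ i, 0 ≤ η i) :
    ∃ T : ℕ → Finset G, (∀ i, T i ⊆ C i) ∧
      (1 - θ) * ∑ i ∈ Finset.range L, ((S i).card * (T i).card : ℝ) ≤ A.card ∧
      θ * ∑ i ∈ Finset.range L,
        (((A \ (Finset.range L).biUnion fun i => S i * T i) ∩ C i).card : ℝ) ≤ 2 * A.card := by
  choose t htC htcard htcov using fun (i : ℕ) (D : Finset G) =>
    exists_almost_disjoint_translates (S i) D (C i) (hθ1.trans (by norm_num : (1 / 2 : ℝ) ≤ 1))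
  let D : ℕ → Finset G := fun n => Nat.rec ∅ (fun i D => D ∪ S i * t i D) n
  have hDsucc : ∀ i, D (i + 1) = D i ∪ S i * t i (D i) := fun _ => rfl
  have hDmono : Monotone D := monotone_nat_of_le_succ fun i => by
    rw [hDsucc]; exact Finset.subset_union_left
  have hDeq : ∀ n, D n = (Finset.range n).biUnion fun i => S i * t i (D i) := by
    intro n
    induction n with
    | zero => rfl
    | succ n ih =>
      rw [hDsucc, Finset.range_add_one, Finset.biUnion_insert, Finset.union_comm, ← ih]
  have hDA : ∀ n, D n ⊆ A := by
    intro n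
    rw [hDeq, Finset.biUnion_subset]
    exact fun i _ => (Finset.mul_subset_mul_left (htC i _)).trans (hCA i)
  have hmass : ∀ n, (1 - θ) * ∑ i ∈ Finset.range n, ((S i).card * (t i (D i)).card : ℝ)
      ≤ (D n).card := by
    intro n
    induction n with
    | zero => simp
    | succ n ih =>
      rw [Finset.sum_range_succ, mul_add]
      have := htcard n (D n)
      rw [← hDsucc] at this
      linarith
  have hDcard : ∀ n, ((D n).card : ℝ) ≤ A.card := fun n => by
    exact_mod_cast Finset.card_le_card (hDA n)
  refine ⟨fun i => t i (D i), fun i => htC i _, (hmass L).trans (hDcard L), ?_⟩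
  rw [← hDeq]
  -- the boundary of the union of the earlier tiles is small compared with `A`
  have hbdry : ∀ i < L, ((((S i)⁻¹ * D i) \ D i).card : ℝ) ≤ η i * (2 * A.card) := by
    intro i hi
    have hsub : ((S i)⁻¹ * D i) \ D i ⊆ (Finset.range i).biUnion fun i' =>
        ((S i)⁻¹ * (S i' * t i' (D i'))) \ (S i' * t i' (D i')) := by
      intro g hg
      rw [Finset.mem_sdiff, Finset.mem_mul] at hg
      obtain ⟨⟨u, hu, d, hd, rfl⟩, hg⟩ := hg
      rw [hDeq, Finset.mem_biUnion] at hd hg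
      obtain ⟨i', hi', hd⟩ := hd
      exact Finset.mem_biUnion.2 ⟨i', hi', Finset.mem_sdiff.2
        ⟨Finset.mul_mem_mul hu hd, fun h => hg ⟨i', hi', h⟩⟩⟩
    have h1 : ((((S i)⁻¹ * D i) \ D i).card : ℝ) ≤ ∑ i' ∈ Finset.range i,
        ((t i' (D i')).card * (((S i)⁻¹ * S i') \ S i').card : ℝ) := by
      have := (Finset.card_le_card hsub).trans (Finset.card_biUnion_le.trans
        (Finset.sum_le_sum fun i' _ => card_boundary_translates_le (S i) (S i') (t i' (D i'))))
      exact_mod_cast this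
    have h2 : ∑ i' ∈ Finset.range i,
        ((t i' (D i')).card * (((S i)⁻¹ * S i') \ S i').card : ℝ) ≤
        η i * ∑ i' ∈ Finset.range i, ((S i').card * (t i' (D i')).card : ℝ) := by
      rw [Finset.mul_sum]
      refine Finset.sum_le_sum fun i' hi' => ?_
      have := hinv i hi i' (Finset.mem_range.1 hi')
      nlinarith [(Nat.cast_nonneg (t i' (D i')).card : (0 : ℝ) ≤ (t i' (D i')).card)]
    refine h1.trans (h2.trans (mul_le_mul_of_nonneg_left ?_ (hη0 i)))
    have h3 := (hmass i).trans (hDcard i)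
    have h4 : (0 : ℝ) ≤ ∑ i' ∈ Finset.range i, ((S i').card * (t i' (D i')).card : ℝ) := by
      exact Finset.sum_nonneg fun i' _ => mul_nonneg (Nat.cast_nonneg _) (Nat.cast_nonneg _)
    nlinarith
  have hlevel : ∀ i ∈ Finset.range L, θ * (((A \ D L) ∩ C i).card : ℝ) ≤
      (((D (i + 1)).card : ℝ) - (D i).card) + θ * (η i * (2 * A.card)) := by
    intro i hi
    have hi := Finset.mem_range.1 hi
    have hdis : Disjoint (A \ D L) (D i) :=
      Finset.disjoint_of_subset_right (hDmono hi.le) Finset.sdiff_disjoint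
    have := card_uncovered_le_card_new (S i) (D i) (D (i + 1)) (A \ D L) (C i) (hS i)
      (hDmono i.le_succ) hdis (htcov i (D i)) hθ0.le
    have := mul_le_mul_of_nonneg_left (hbdry i hi) hθ0.le
    linarith
  rw [Finset.mul_sum]
  refine (Finset.sum_le_sum hlevel).trans ?_
  rw [Finset.sum_add_distrib, Finset.sum_range_sub (fun i => ((D i).card : ℝ)), ← Finset.mul_sum,
    ← Finset.sum_mul]
  have h0 : ((D 0).card : ℝ) = 0 := by simp [D]
  have hA : (0 : ℝ) ≤ A.card := Nat.cast_nonneg _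
  have := hDcard L
  have h5 : (∑ i ∈ Finset.range L, η i) * (2 * (A.card : ℝ)) ≤ 1 * (2 * A.card) :=
    mul_le_mul_of_nonneg_right hη (by linarith)
  have h6 : θ * ((∑ i ∈ Finset.range L, η i) * (2 * (A.card : ℝ))) ≤ 1 / 2 * (2 * A.card) :=
    (mul_le_mul_of_nonneg_left h5 hθ0.le).trans (by nlinarith)
  linarith

end Tiling

/-! ### Invariance of Følner sets -/

section Folner

variable {G : Type*} [Group G] {F : ℕ → Finset G}

open Classical in
theorem IsFolnerSeq.eventually_sum_card_symmDiff_le (hF : IsFolnerSeq F) (S : Finset G) {η : ℝ}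
    (hη : 0 < η) :
    ∀ᶠ n in atTop, ((∑ g ∈ S, (symmDiff (F n) (g • F n)).card : ℕ) : ℝ) ≤ η * (F n).card := by
  have h := tendsto_finsetSum S fun g _ => hF.tendsto_symmDiff g
  rw [Finset.sum_const_zero] at h
  filter_upwards [h.eventually_le_const hη] with n hn
  have hpos : (0 : ℝ) < (F n).card := by exact_mod_cast (hF.nonempty n).card_pos
  rw [← Finset.sum_div, div_le_iff₀ hpos] at hn
  exact_mod_cast hn

open Classical in
theorem inv_mul_sdiff_subset (S T : Finset G) :
    (S⁻¹ * T) \ T ⊆ S⁻¹.biUnion fun g => symmDiff T (g • T) := by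
  intro x hx
  rw [Finset.mem_sdiff, Finset.mem_mul] at hx
  obtain ⟨⟨g, hg, t, ht, rfl⟩, hx⟩ := hx
  exact Finset.mem_biUnion.2 ⟨g, hg, Finset.mem_symmDiff.2
    (Or.inr ⟨Finset.smul_mem_smul_finset ht, hx⟩)⟩

open Classical in
theorem filter_not_translate_subset (S T : Finset G) :
    (T.filter fun c => ¬ S * {c} ⊆ T) ⊆ S⁻¹.biUnion fun g => symmDiff T (g • T) := by
  intro c hc
  rw [Finset.mem_filter, Finset.not_subset] at hc
  obtain ⟨hcT, x, hx, hxT⟩ := hc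
  obtain ⟨s, hs, c', hc', rfl⟩ := Finset.mem_mul.1 hx
  rw [Finset.mem_singleton] at hc'
  subst hc'
  refine Finset.mem_biUnion.2 ⟨s⁻¹, Finset.inv_mem_inv hs, Finset.mem_symmDiff.2
    (Or.inl ⟨hcT, fun h => hxT ?_⟩)⟩
  rwa [← Finset.inv_smul_mem_iff, inv_inv, smul_eq_mul] at h

open Classical in
theorem IsFolnerSeq.eventually_card_inv_mul_sdiff_le (hF : IsFolnerSeq F) (S : Finset G) {η : ℝ}
    (hη : 0 < η) :
    ∀ᶠ n in atTop, (((S⁻¹ * F n) \ F n).card : ℝ) ≤ η * (F n).card := by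
  filter_upwards [hF.eventually_sum_card_symmDiff_le S⁻¹ hη] with n hn
  refine le_trans ?_ hn
  exact_mod_cast (Finset.card_le_card (inv_mul_sdiff_subset S (F n))).trans Finset.card_biUnion_le

open Classical in
theorem IsFolnerSeq.eventually_card_not_translate_subset_le (hF : IsFolnerSeq F) (S : Finset G)
    {η : ℝ} (hη : 0 < η) :
    ∀ᶠ n in atTop, (((F n).filter fun c => ¬ S * {c} ⊆ F n).card : ℝ) ≤ η * (F n).card := by
  filter_upwards [hF.eventually_sum_card_symmDiff_le S⁻¹ hη] with n hn
  refine le_trans ?_ hn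
  exact_mod_cast (Finset.card_le_card (filter_not_translate_subset S (F n))).trans
    Finset.card_biUnion_le

open Classical in
/-- A Følner sequence has a subsequence each term of which is much more invariant than all the
earlier ones, the defects of invariance being summable. -/
theorem IsFolnerSeq.exists_invariant_subseq (hF : IsFolnerSeq F) :
    ∃ κ : ℕ → ℕ, StrictMono κ ∧ ∀ i j, i < j →
      (((F (κ i))⁻¹ * F (κ j)) \ F (κ j)).card ≤ (1 / 2 : ℝ) ^ (i + 1) * (F (κ j)).card := by
  obtain ⟨κ, hκ⟩ := exists_seq_of_forall_finset_exists (fun _ : ℕ => True)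
    (fun k l => k < l ∧ (((F k)⁻¹ * F l) \ F l).card ≤ (1 / 2 : ℝ) ^ (k + 1) * (F l).card) (by
      intro s _
      have h : ∀ᶠ l in atTop, ∀ k ∈ s,
          k < l ∧ (((F k)⁻¹ * F l) \ F l).card ≤ (1 / 2 : ℝ) ^ (k + 1) * (F l).card :=
        (Finset.eventually_all s).2 fun k _ => (eventually_gt_atTop k).and
          (hF.eventually_card_inv_mul_sdiff_le (F k) (by positivity))
      obtain ⟨l, hl⟩ := h.exists
      exact ⟨l, trivial, hl⟩)
  have hmono : StrictMono κ := fun i j hij => (hκ.2 i j hij).1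
  refine ⟨κ, hmono, fun i j hij => (hκ.2 i j hij).2.trans ?_⟩
  refine mul_le_mul_of_nonneg_right ?_ (Nat.cast_nonneg _)
  exact pow_le_pow_of_le_one (by norm_num) (by norm_num) (Nat.succ_le_succ (hmono.id_le i))

end Folner

/-! ### Separated and spanning sets of fibres -/

section Spanning

variable {G X Y : Type*} [MetricSpace X] [MetricSpace Y]

theorem bowenDist_nonneg [SMul G X] (A : Finset G) (x y : X) : 0 ≤ bowenDist A x y :=
  NNReal.coe_nonneg _

theorem bowenDist_self [SMul G X] (A : Finset G) (x : X) : bowenDist A x x = 0 :=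
  le_antisymm ((bowenDist_le_iff A x x le_rfl).2 fun _ _ => (dist_self _).le)
    (bowenDist_nonneg A x x)

theorem bowenDist_comm [SMul G X] (A : Finset G) (x y : X) : bowenDist A x y = bowenDist A y x := by
  simp only [bowenDist, nndist_comm]

theorem IsSeparatedIn.card_le [SMul G X] {A : Finset G} {ε K : ℝ} {Z : Set X} (hK : 0 ≤ K)
    (h : separatedSum A (fun _ => 0) ε Z ≤ ENNReal.ofReal K) {E : Finset X}
    (hE : IsSeparatedIn A ε Z E) : (E.card : ℝ) ≤ K := by
  have h1 := (le_iSup₂ (f := fun (E : Set X) (_ : IsSeparatedIn A ε Z E) =>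
    ∑' x : E, ENNReal.ofReal (Real.exp (orbitSum A (fun _ => 0) x.1))) (E : Set X) hE).trans h
  simp only [orbitSum, Finset.sum_const_zero, Real.exp_zero, ENNReal.ofReal_one,
    Finset.coe_sort_coe, tsum_fintype, Finset.sum_const, Finset.card_univ, Fintype.card_coe,
    nsmul_eq_mul, mul_one] at h1
  rwa [← ENNReal.ofReal_natCast, ENNReal.ofReal_le_ofReal_iff hK] at h1

/-- A maximal separated set is spanning. -/
theorem exists_spanning_of_separatedSum_le [SMul G X] {A : Finset G} {ε K : ℝ} {Z : Set X}
    (hε : 0 ≤ ε) (hK : 0 ≤ K) (h : separatedSum A (fun _ => 0) ε Z ≤ ENNReal.ofReal K) :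
    ∃ s : Finset X, (s.card : ℝ) ≤ K ∧ ∀ x ∈ Z, ∃ p ∈ s, bowenDist A p x ≤ ε := by
  classical
  set N : Set ℕ := {n | ∃ E : Finset X, IsSeparatedIn A ε Z E ∧ E.card = n}
  have hne : N.Nonempty := ⟨0, ∅, ⟨by simp, by simp⟩, rfl⟩
  have hbdd : BddAbove N := by
    refine ⟨⌊K⌋₊, ?_⟩
    rintro _ ⟨E, hE, rfl⟩
    exact Nat.le_floor (hE.card_le hK h)
  obtain ⟨E, hE, hcard⟩ := Nat.sSup_mem hne hbdd
  refine ⟨E, hE.card_le hK h, fun x hx => ?_⟩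
  by_contra! hlt
  have hxE : x ∉ E := fun hxE => by
    have := hlt x hxE
    rw [bowenDist_self] at this
    linarith
  have hins : IsSeparatedIn A ε Z (insert x E : Finset X) := by
    rw [Finset.coe_insert]
    refine ⟨Set.insert_subset hx hE.1, ?_⟩
    rintro u (rfl | hu) v (rfl | hv) huv
    · exact absurd rfl huv
    · rw [bowenDist_comm]; exact hlt v hv
    · exact hlt u hu
    · exact hE.2 u hu v hv huv
  have := le_csSup hbdd ⟨_, hins, rfl⟩
  rw [Finset.card_insert_of_notMem hxE, ← hcard] at this
  omega

/-- The points `y` for which the preimage of the closed `δ`-ball around `y` is `(A, ε)`-spanned by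
at most `exp (b |A|)` points. -/
def fewSpanning [SMul G X] (π : X → Y) (A : Finset G) (b ε δ : ℝ) : Set Y :=
  {y | ∃ s : Finset X, (s.card : ℝ) ≤ Real.exp (b * A.card) ∧
    ∀ x, dist (π x) y ≤ δ → ∃ p ∈ s, ∀ g ∈ A, dist (g • p) (g • x) ≤ ε}

theorem mem_fewSpanning_of_dist_le [SMul G X] {π : X → Y} {A : Finset G} {b ε δ δ' : ℝ} {y y' : Y}
    (hy : y ∈ fewSpanning π A b ε δ) (h : dist y' y + δ' ≤ δ) :
    y' ∈ fewSpanning π A b ε δ' := by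
  obtain ⟨s, hs, hspan⟩ := hy
  exact ⟨s, hs, fun x hx => hspan x (by linarith [dist_triangle (π x) y' y])⟩

theorem separatedSum_le_of_log_div_lt [SMul G X] {A : Finset G} (hA : A.Nonempty) {ε b : ℝ}
    {Z : Set X} (h : ENNReal.log (separatedSum A (fun _ => 0) ε Z) / ((A.card : ℝ) : EReal) < b) :
    separatedSum A (fun _ => 0) ε Z ≤ ENNReal.ofReal (Real.exp (b * A.card)) := by
  have hpos : (0 : ℝ) < A.card := by exact_mod_cast hA.card_pos
  rw [EReal.div_lt_iff (by exact_mod_cast hpos) (EReal.coe_ne_top _), ← EReal.coe_mul] at h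
  rw [← EReal.exp_coe, ← ENNReal.log_le_log_iff, EReal.log_exp]
  exact h.le

/-- A spanning set of a fibre spans the preimage of a neighbourhood, `π` being a closed map. -/
theorem eventually_mem_fewSpanning [SMul G X] [ContinuousConstSMul G X] [CompactSpace X]
    {F : ℕ → Finset G} (hF : ∀ n, (F n).Nonempty) {π : X → Y} (hπ : Continuous π) {y : Y} {b ε : ℝ}
    (hε : 0 < ε) (h : ucEntropy F (π ⁻¹' {y}) < b) :
    ∀ᶠ k in atTop, ∃ δ > 0, y ∈ fewSpanning π (F k) b ε δ := by
  have h1 : ucPressureAt F (fun _ => 0) (ε / 2) (π ⁻¹' {y}) < b :=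
    (le_iSup₂ (f := fun (ε : ℝ) (_ : 0 < ε) => ucPressureAt F (fun _ => 0) ε (π ⁻¹' {y}))
      (ε / 2) (half_pos hε)).trans_lt h
  filter_upwards [eventually_lt_of_limsup_lt h1] with k hk
  obtain ⟨s, hs, hspan⟩ := exists_spanning_of_separatedSum_le (half_pos hε).le
    (Real.exp_pos _).le (separatedSum_le_of_log_div_lt (hF k) hk)
  set O : Set X := ⋃ p ∈ s, ⋂ g ∈ F k, {x | dist (g • p) (g • x) < ε}
  have hO : IsOpen O := isOpen_biUnion fun p _ => isOpen_biInter_finset fun g _ =>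
    isOpen_lt (continuous_const.dist (continuous_const_smul g)) continuous_const
  have hfib : y ∉ π '' Oᶜ := by
    rintro ⟨x, hxO, hxy⟩
    obtain ⟨p, hp, hpx⟩ := hspan x hxy
    refine hxO (Set.mem_biUnion hp (Set.mem_iInter₂.2 fun g hg => ?_))
    exact ((bowenDist_le_iff _ _ _ (half_pos hε).le).1 hpx g hg).trans_lt (half_lt_self hε)
  have hcl : IsClosed (π '' Oᶜ) := (hO.isClosed_compl.isCompact.image hπ).isClosed
  obtain ⟨δ, hδ, hball⟩ := Metric.isOpen_iff.1 hcl.isOpen_compl y hfib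
  refine ⟨δ / 2, half_pos hδ, s, hs, fun x hx => ?_⟩
  have hxO : x ∈ O := by
    by_contra hxO
    exact hball (Metric.mem_ball.2 (hx.trans_lt (half_lt_self hδ))) ⟨x, hxO, rfl⟩
  obtain ⟨p, hp, hpx⟩ := Set.mem_iUnion₂.1 hxO
  exact ⟨p, hp, fun g hg => (Set.mem_iInter₂.1 hpx g hg).le⟩

open Classical in
/-- Asking for `m` good indices among the first `L`, rather than for all large ones, is an open
condition, so compactness makes `L` and `δ` uniform in `y`. -/
theorem exists_forall_le_card_fewSpanning [SMul G X] [CompactSpace Y] {π : X → Y}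
    {S : ℕ → Finset G} {b ε : ℝ}
    (h : ∀ y : Y, ∀ᶠ k in atTop, ∃ δ > 0, y ∈ fewSpanning π (S k) b ε δ) (m : ℕ) :
    ∃ L : ℕ, ∃ δ > 0, ∀ y : Y,
      m ≤ ((Finset.range L).filter fun j => y ∈ fewSpanning π (S j) b ε δ).card := by
  have hloc : ∀ y : Y, ∃ L : ℕ, ∃ δ > 0, ∀ y' ∈ Metric.ball y δ,
      m ≤ ((Finset.range L).filter fun j => y' ∈ fewSpanning π (S j) b ε δ).card := by
    intro y
    obtain ⟨K, hK⟩ := eventually_atTop.1 (h y)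
    choose! r hr0 hr using hK
    obtain ⟨δ, hδ0, hδ⟩ : ∃ δ > 0, ∀ k ∈ Finset.Ico K (K + m), δ ≤ r k := by
      have : ∀ᶠ δ in 𝓝[>] (0 : ℝ), ∀ k ∈ Finset.Ico K (K + m), δ ≤ r k :=
        (Finset.eventually_all _).2 fun k hk => mem_of_superset
          (Ioc_mem_nhdsGT (hr0 k (Finset.mem_Ico.1 hk).1)) fun δ hδ => hδ.2
      obtain ⟨δ, h1, h2⟩ := (this.and self_mem_nhdsWithin).exists
      exact ⟨δ, h2, h1⟩
    refine ⟨K + m, δ / 2, half_pos hδ0, fun y' hy' => ?_⟩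
    calc m = (Finset.Ico K (K + m)).card := by simp
      _ ≤ _ := Finset.card_le_card fun k hk => by
        have hk' := Finset.mem_Ico.1 hk
        refine Finset.mem_filter.2 ⟨Finset.mem_range.2 hk'.2,
          mem_fewSpanning_of_dist_le (hr k hk'.1) ?_⟩
        have := Metric.mem_ball.1 hy'
        have := hδ k hk
        linarith
  choose L δ hδ0 hgood using hloc
  obtain ⟨t, ht⟩ := isCompact_univ.elim_finite_subcover (fun y => Metric.ball y (δ y))
    (fun y => Metric.isOpen_ball)
    (fun y _ => Set.mem_iUnion.2 ⟨y, Metric.mem_ball_self (hδ0 y)⟩)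
  obtain ⟨δ', hδ'0, hδ'⟩ : ∃ δ' > 0, ∀ y ∈ t, δ' ≤ δ y := by
    have : ∀ᶠ δ' in 𝓝[>] (0 : ℝ), ∀ y ∈ t, δ' ≤ δ y :=
      (Finset.eventually_all _).2 fun y _ => mem_of_superset
        (Ioc_mem_nhdsGT (hδ0 y)) fun δ hδ => hδ.2
    obtain ⟨δ', h1, h2⟩ := (this.and self_mem_nhdsWithin).exists
    exact ⟨δ', h2, h1⟩
  refine ⟨t.sup L, δ', hδ'0, fun y => ?_⟩
  obtain ⟨z, hz, hyz⟩ := Set.mem_iUnion₂.1 (ht (Set.mem_univ y))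
  refine (hgood z y hyz).trans (Finset.card_le_card fun j hj => ?_)
  rw [Finset.mem_filter, Finset.mem_range] at hj ⊢
  refine ⟨hj.1.trans_le (Finset.le_sup hz), mem_fewSpanning_of_dist_le hj.2 ?_⟩
  rw [dist_self, zero_add]
  exact hδ' z hz

end Spanning

section Counting

variable {G X : Type*} [Group G] [MetricSpace X] [MulAction G X]

/-- If `A` is covered by the translates `B i * c i` and the points `c i • x`, `x ∈ E`, are
`(B i, ε / 2)`-spanned by `s i`, then an `(A, ε)`-separated set `E` is coded by `∏ i, s i`. -/
theorem IsSeparatedIn.card_le_prod {A : Finset G} {ε : ℝ} (hε : 0 ≤ ε) {Z : Set X} {E : Finset X}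
    (hE : IsSeparatedIn A ε Z E) {ι : Type*} (I : Finset ι) (B : ι → Finset G) (c : ι → G)
    (s : ι → Finset X)
    (hspan : ∀ i ∈ I, ∀ x ∈ E, ∃ p ∈ s i, ∀ g ∈ B i, dist (g • p) (g • c i • x) ≤ ε / 2)
    (hcov : ∀ h ∈ A, ∃ i ∈ I, ∃ g ∈ B i, h = g * c i) :
    E.card ≤ ∏ i ∈ I, (s i).card := by
  classical
  choose! φ hφs hφ using hspan
  rw [← Finset.card_pi]
  refine Finset.card_le_card_of_injOn (fun x i _ => φ i x)
    (fun x hx => Finset.mem_pi.2 fun i hi => hφs i hi x hx) ?_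
  intro x hx x' hx' hxx'
  by_contra hne
  refine (hE.2 x hx x' hx' hne).not_ge ((bowenDist_le_iff A x x' hε).2 fun h hh => ?_)
  obtain ⟨i, hi, g, hg, rfl⟩ := hcov h hh
  have h1 := hφ i hi x hx g hg
  have h2 := hφ i hi x' hx' g hg
  have h3 : φ i x = φ i x' := congrFun (congrFun hxx' i) hi
  rw [← h3] at h2
  rw [mul_smul, mul_smul]
  linarith [dist_triangle_left (g • c i • x) (g • c i • x') (g • φ i x)]

end Counting

/-! ### Separated sets in preimages of Bowen balls -/

section Bowen

variable {G X Y : Type*} [Group G] [MetricSpace X] [MetricSpace Y] [MulAction G X] [MulAction G Y]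

open Classical in
/-- A separated set in the preimage of a Bowen ball is coded by a quasi-tiling of `A` whose tiles
have few spanning points, together with the positions `R` left uncovered by the tiles. -/
theorem card_separated_le_of_tiling {π : X → Y} (hπ : ∀ (g : G) (x : X), π (g • x) = g • π x)
    {A R : Finset G} {L : ℕ} {S T : ℕ → Finset G} {b ε δ : ℝ} (hε : 0 ≤ ε) (hδ : 0 ≤ δ) {y : Y}
    (hTA : ∀ i, T i ⊆ A)
    (hT : ∀ i < L, ∀ c ∈ T i, c • y ∈ fewSpanning π (S i) b (ε / 2) δ)
    (hR : A \ (Finset.range L).biUnion (fun i => S i * T i) ⊆ R)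
    {s₀ : Finset X} (hs₀ : ∀ x, ∃ p ∈ s₀, dist p x ≤ ε / 2) {E : Finset X}
    (hE : IsSeparatedIn A ε {x | bowenDist A (π x) y ≤ δ} E) :
    (E.card : ℝ) ≤ Real.exp (b * ∑ i ∈ Finset.range L, ((S i).card * (T i).card : ℝ) +
      R.card * Real.log (s₀.card + 1)) := by
  have hT' : ∀ i, ∀ c, (i < L ∧ c ∈ T i) → ∃ s : Finset X,
      (s.card : ℝ) ≤ Real.exp (b * (S i).card) ∧
      ∀ x, dist (π x) (c • y) ≤ δ → ∃ p ∈ s, ∀ g ∈ S i, dist (g • p) (g • x) ≤ ε / 2 :=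
    fun i c hic => hT i hic.1 c hic.2
  choose! s hs hspan using hT'
  have hcard := hE.card_le_prod hε
    (((Finset.range L).sigma T).disjSum R) (Sum.elim (fun t => S t.1) fun _ => {1})
    (Sum.elim (fun t => t.2) id) (Sum.elim (fun t => s t.1 t.2) fun _ => s₀) (by
      rintro (⟨i, c⟩ | c) hi x hx
      · rw [Finset.inl_mem_disjSum, Finset.mem_sigma, Finset.mem_range] at hi
        refine hspan i c hi (c • x) ?_
        rw [hπ]
        exact (bowenDist_le_iff A _ _ hδ).1 (hE.1 hx) c (hTA i hi.2)
      · obtain ⟨p, hp, hpx⟩ := hs₀ (c • x)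
        refine ⟨p, hp, fun g hg => ?_⟩
        rw [Sum.elim_inr, Finset.mem_singleton] at hg
        subst hg
        simpa using hpx) (by
      intro h hh
      by_cases hc : h ∈ (Finset.range L).biUnion (fun i => S i * T i)
      · obtain ⟨i, hi, hh⟩ := Finset.mem_biUnion.1 hc
        obtain ⟨g, hg, c, hcT, rfl⟩ := Finset.mem_mul.1 hh
        exact ⟨Sum.inl ⟨i, c⟩, Finset.inl_mem_disjSum.2 (Finset.mem_sigma.2 ⟨hi, hcT⟩), g, hg, rfl⟩
      · exact ⟨Sum.inr h, Finset.inr_mem_disjSum.2 (hR (Finset.mem_sdiff.2 ⟨hh, hc⟩)), 1,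
          Finset.mem_singleton_self 1, (one_mul h).symm⟩)
  rw [Finset.prod_disjSum, Finset.prod_sigma] at hcard
  simp only [Sum.elim_inl, Sum.elim_inr, Finset.prod_const] at hcard
  have h1 : ∏ i ∈ Finset.range L, ∏ c ∈ T i, ((s i c).card : ℝ) ≤
      Real.exp (b * ∑ i ∈ Finset.range L, ((S i).card * (T i).card : ℝ)) := by
    rw [Finset.mul_sum, Real.exp_sum]
    refine Finset.prod_le_prod (fun i _ => Finset.prod_nonneg fun c _ => Nat.cast_nonneg _)
      fun i hi => ?_
    have h := Finset.prod_le_prod (s := T i) (f := fun c => ((s i c).card : ℝ))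
      (fun c _ => Nat.cast_nonneg _) (fun c hc => hs i c ⟨Finset.mem_range.1 hi, hc⟩)
    rw [Finset.prod_const, ← Real.exp_nat_mul] at h
    refine h.trans (le_of_eq ?_)
    ring_nf
  have h2 : (s₀.card : ℝ) ^ R.card ≤ Real.exp (R.card * Real.log (s₀.card + 1)) := by
    rw [Real.exp_nat_mul, Real.exp_log (by positivity)]
    exact pow_le_pow_left₀ (Nat.cast_nonneg _) (by linarith) _
  rw [Real.exp_add]
  refine le_trans ?_ (mul_le_mul h1 h2 (by positivity) (Real.exp_pos _).le)
  exact_mod_cast hcard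

open Classical in
/-- If every fibre of `π` has upper capacity entropy at most `a`, then the preimages of small Bowen
balls have separated sets of cardinality at most `exp ((a + τ) |F n|)`, uniformly in the centre. -/
theorem exists_eventually_card_separated_le [CompactSpace X] [ContinuousConstSMul G X]
    [CompactSpace Y] {π : X → Y} (hπ : IsFactorMap G π) {F : ℕ → Finset G} (hF : IsFolnerSeq F)
    {a : ℝ} (ha : 0 ≤ a) (hfib : ∀ y, ucEntropy F (π ⁻¹' {y}) ≤ a) {ε τ : ℝ} (hε : 0 < ε)
    (hτ : 0 < τ) :
    ∃ δ > 0, ∀ᶠ n in atTop, ∀ y : Y, ∀ E : Finset X,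
      IsSeparatedIn (F n) ε {x | bowenDist (F n) (π x) y ≤ δ} E →
        (E.card : ℝ) ≤ Real.exp ((a + τ) * (F n).card) := by
  set b : ℝ := a + τ / 3
  have hb : 0 < b := by positivity
  -- the overlaps of the tiles contribute a factor `1 / (1 - θ) ≤ 1 + 2 θ` to the exponent
  set θ : ℝ := min (1 / 2) (τ / (6 * (b + 1)))
  have hθ0 : 0 < θ := lt_min (by norm_num) (by positivity)
  have hθ1 : θ ≤ 1 / 2 := min_le_left _ _
  have hθb : 2 * θ * b ≤ τ / 3 := by
    have h1 : θ * (6 * (b + 1)) ≤ τ := (le_div_iff₀ (by positivity)).1 (min_le_right _ _)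
    nlinarith
  obtain ⟨s₀, hs₀⟩ : ∃ s₀ : Finset X, ∀ x, ∃ p ∈ s₀, dist p x ≤ ε / 2 := by
    obtain ⟨t, _, htfin, ht⟩ :=
      finite_cover_balls_of_compact (isCompact_univ (X := X)) (half_pos hε)
    refine ⟨htfin.toFinset, fun x => ?_⟩
    obtain ⟨p, hp, hx⟩ := Set.mem_iUnion₂.1 (ht (Set.mem_univ x))
    exact ⟨p, htfin.mem_toFinset.2 hp, (dist_comm p x).trans_le (Metric.mem_ball.1 hx).le⟩
  set l : ℝ := Real.log (s₀.card + 1)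
  have hl : 0 ≤ l := Real.log_nonneg (by linarith [(Nat.cast_nonneg s₀.card : (0 : ℝ) ≤ _)])
  -- with this `m`, the uncovered positions contribute at most `(τ / 3) |F n|` to the exponent
  obtain ⟨m, hm⟩ := exists_nat_gt (9 * l / (θ * τ))
  have hm' : 9 * l < m * (θ * τ) := (div_lt_iff₀ (by positivity)).1 hm
  obtain ⟨κ, hκmono, hκ⟩ := hF.exists_invariant_subseq
  obtain ⟨L, δ, hδ, hgood⟩ := exists_forall_le_card_fewSpanning (π := π)
    (S := fun j => F (κ j)) (b := b) (ε := ε / 2) (fun y => hκmono.tendsto_atTop.eventually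
      (eventually_mem_fewSpanning hF.nonempty hπ.continuous (half_pos hε)
        ((hfib y).trans_lt (EReal.coe_lt_coe_iff.2 (by simp only [b]; linarith))))) m
  refine ⟨δ, hδ, ?_⟩
  have hinv : ∀ᶠ n in atTop, ∀ j ∈ Finset.range L,
      (((F n).filter fun c => ¬ F (κ j) * {c} ⊆ F n).card : ℝ) ≤ 1 / (L + 1) * (F n).card :=
    (Finset.eventually_all _).2 fun j _ =>
      hF.eventually_card_not_translate_subset_le (F (κ j)) (by positivity)
  filter_upwards [hinv] with n hn y E hE
  set A := F n
  -- the largest shapes are laid first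
  set S : ℕ → Finset G := fun i => F (κ (L - 1 - i))
  set C : ℕ → Finset G := fun i =>
    A.filter fun c => S i * {c} ⊆ A ∧ c • y ∈ fewSpanning π (S i) b (ε / 2) δ
  have hCA : ∀ i, S i * C i ⊆ A := by
    intro i g hg
    obtain ⟨u, hu, c, hc, rfl⟩ := Finset.mem_mul.1 hg
    exact (Finset.mem_filter.1 hc).2.1 (Finset.mul_mem_mul hu (Finset.mem_singleton_self c))
  obtain ⟨T, hTC, hTmass, hTcov⟩ := exists_quasiTiling A L S C
    (fun i => (1 / 2 : ℝ) ^ (L - 1 - i + 1)) hθ0 hθ1 (fun i => hF.nonempty _) hCA (by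
      rw [Finset.sum_range_reflect (fun j => (1 / 2 : ℝ) ^ (j + 1)) L]
      have h1 : ∑ j ∈ Finset.range L, (1 / 2 : ℝ) ^ (j + 1) = 1 - (1 / 2) ^ L := by
        clear * -
        induction L with
        | zero => simp
        | succ L ih => rw [Finset.sum_range_succ, ih]; ring
      rw [h1]
      have : (0 : ℝ) ≤ (1 / 2) ^ L := by positivity
      linarith)
    (fun i hi i' hi' => hκ _ _ (by omega)) (fun i => by positivity)
  set R : Finset G := A \ (Finset.range L).biUnion fun i => S i * T i
  have hRA : R ⊆ A := Finset.sdiff_subset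
  have hTA : ∀ i, T i ⊆ A := fun i => (hTC i).trans (Finset.filter_subset _ _)
  have hA : (0 : ℝ) ≤ A.card := Nat.cast_nonneg _
  -- every position has at least `m` admissible shapes, apart from boundary effects
  have hcount : (m : ℝ) * R.card ≤
      ∑ i ∈ Finset.range L, ((R ∩ C i).card : ℝ) + A.card := by
    have h1 : m * R.card ≤ ∑ i ∈ Finset.range L,
        (R.filter fun c => c • y ∈ fewSpanning π (S i) b (ε / 2) δ).card := by
      rw [Finset.sum_range_reflect (fun j =>
        (R.filter fun c => c • y ∈ fewSpanning π (F (κ j)) b (ε / 2) δ).card) L]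
      simp only [Finset.card_filter]
      rw [Finset.sum_comm, mul_comm, ← smul_eq_mul]
      refine Finset.card_nsmul_le_sum _ _ _ fun c _ => ?_
      rw [← Finset.card_filter]
      exact hgood (c • y)
    have h2 : ∀ i ∈ Finset.range L,
        ((R.filter fun c => c • y ∈ fewSpanning π (S i) b (ε / 2) δ).card : ℝ) ≤
          (R ∩ C i).card + 1 / (L + 1) * A.card := by
      intro i hi
      have hsub : (R.filter fun c => c • y ∈ fewSpanning π (S i) b (ε / 2) δ) ⊆
          (R ∩ C i) ∪ A.filter fun c => ¬ S i * {c} ⊆ A := by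
        intro c hc
        rw [Finset.mem_filter] at hc
        have hcA := hRA hc.1
        by_cases hcS : S i * {c} ⊆ A
        · exact Finset.mem_union_left _ (Finset.mem_inter.2
            ⟨hc.1, Finset.mem_filter.2 ⟨hcA, hcS, hc.2⟩⟩)
        · exact Finset.mem_union_right _ (Finset.mem_filter.2 ⟨hcA, hcS⟩)
      have h3 := (Finset.card_le_card hsub).trans (Finset.card_union_le _ _)
      have h4 := hn (L - 1 - i) (by
        have := Finset.mem_range.1 hi
        exact Finset.mem_range.2 (by omega))
      have h5 : ((R.filter fun c => c • y ∈ fewSpanning π (S i) b (ε / 2) δ).card : ℝ) ≤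
        (R ∩ C i).card + (A.filter fun c => ¬ S i * {c} ⊆ A).card := by exact_mod_cast h3
      linarith
    have h6 : (L : ℝ) * (1 / (L + 1) * A.card) ≤ A.card := by
      have : (L : ℝ) * (1 / (L + 1)) ≤ 1 := by
        rw [mul_one_div, div_le_one (by positivity)]
        linarith
      nlinarith
    calc (m : ℝ) * R.card ≤ ∑ i ∈ Finset.range L,
          ((R.filter fun c => c • y ∈ fewSpanning π (S i) b (ε / 2) δ).card : ℝ) := by
            exact_mod_cast h1
      _ ≤ ∑ i ∈ Finset.range L, ((R ∩ C i).card + 1 / (L + 1) * A.card : ℝ) :=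
          Finset.sum_le_sum h2
      _ ≤ _ := by
          rw [Finset.sum_add_distrib, Finset.sum_const, Finset.card_range, nsmul_eq_mul]
          linarith
  have hRl : R.card * l ≤ τ / 3 * A.card := by
    have h1 : θ * (m * R.card) ≤ 3 * A.card := by
      have := mul_le_mul_of_nonneg_left hcount hθ0.le
      nlinarith
    have hR0 : (0 : ℝ) ≤ R.card := Nat.cast_nonneg _
    have h2 : 9 * l * R.card ≤ 3 * A.card * τ := by
      calc 9 * l * R.card ≤ m * (θ * τ) * R.card := mul_le_mul_of_nonneg_right hm'.le hR0
        _ = θ * (m * R.card) * τ := by ring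
        _ ≤ _ := mul_le_mul_of_nonneg_right h1 hτ.le
    linarith
  have hmass : b * ∑ i ∈ Finset.range L, ((S i).card * (T i).card : ℝ) ≤
      (b + τ / 3) * A.card := by
    set V := ∑ i ∈ Finset.range L, ((S i).card * (T i).card : ℝ)
    have h1 : V ≤ (1 + 2 * θ) * A.card := by
      have h2 : (0 : ℝ) ≤ θ * (1 - 2 * θ) := mul_nonneg hθ0.le (by linarith)
      nlinarith [mul_le_mul_of_nonneg_left hTmass (by linarith : (0 : ℝ) ≤ 1 + 2 * θ),
        (Finset.sum_nonneg fun i _ => mul_nonneg (Nat.cast_nonneg _) (Nat.cast_nonneg _) :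
          (0 : ℝ) ≤ ∑ i ∈ Finset.range L, ((S i).card * (T i).card : ℝ))]
    calc b * V ≤ b * ((1 + 2 * θ) * A.card) := mul_le_mul_of_nonneg_left h1 hb.le
      _ = (b + 2 * θ * b) * A.card := by ring
      _ ≤ _ := mul_le_mul_of_nonneg_right (by linarith) hA
  refine (card_separated_le_of_tiling (R := R) (L := L) (b := b) hπ.map_smul hε.le hδ.le hTA
    (fun i _ c hc => (Finset.mem_filter.1 (hTC i hc)).2.2) subset_rfl hs₀ hE).trans
    (Real.exp_le_exp.2 ?_)
  have : (a + τ) * (A.card : ℝ) = (b + τ / 3) * A.card + τ / 3 * A.card := by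
    simp only [b]; ring
  linarith

end Bowen

/-! ### Packings and factor maps -/

theorem orbitSum_comp {G X Y : Type*} [SMul G X] [SMul G Y] {π : X → Y}
    (hπ : ∀ (g : G) (x : X), π (g • x) = g • π x) (A : Finset G) (f : Y → ℝ) (x : X) :
    orbitSum A (f ∘ π) x = orbitSum A f (π x) := by
  simp only [orbitSum, Function.comp_apply, hπ]

section Packing

variable {G X Y : Type*} [MetricSpace X] [MetricSpace Y]

theorem bowenDist_triangle [SMul G X] (A : Finset G) (x y z : X) :
    bowenDist A x z ≤ bowenDist A x y + bowenDist A y z := by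
  refine (bowenDist_le_iff A x z (add_nonneg (bowenDist_nonneg A x y)
    (bowenDist_nonneg A y z))).2 fun g hg => (dist_triangle _ (g • y) _).trans (add_le_add ?_ ?_)
  · exact (bowenDist_le_iff A x y (bowenDist_nonneg A x y)).1 le_rfl g hg
  · exact (bowenDist_le_iff A y z (bowenDist_nonneg A y z)).1 le_rfl g hg

theorem mem_bowenClosedBall_self [SMul G X] (A : Finset G) (x : X) {ε : ℝ} (hε : 0 ≤ ε) :
    x ∈ bowenClosedBall A x ε := (bowenDist_self A x).trans_le hε

theorem IsPacking.tsum_le_packingPre [SMul G X] {F : ℕ → Finset G} {N : ℕ} {ε : ℝ} {Z : Set X}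
    {S : Set (ℕ × X)} (hS : IsPacking F N ε Z S) (f : X → ℝ) (s : ℝ) :
    ∑' p : S, ENNReal.ofReal (Real.exp (-s * ((F p.1.1).card : ℝ) + orbitSum (F p.1.1) f p.1.2)) ≤
      packingPre F f N s ε Z :=
  le_iSup₂ (f := fun (S : Set (ℕ × X)) (_ : IsPacking F N ε Z S) => ∑' p : S, ENNReal.ofReal
    (Real.exp (-s * ((F p.1.1).card : ℝ) + orbitSum (F p.1.1) f p.1.2))) S hS

/-- A disjoint family of balls for the Bowen metric of a single `F n` is a packing. -/
theorem tsum_le_packingPre_of_pairwiseDisjoint {G X Y : Type*} [MetricSpace Y] [SMul G Y]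
    {π : X → Y} {F : ℕ → Finset G} {N n : ℕ} (hn : N ≤ n) {δ : ℝ} (hδ : 0 ≤ δ) {W : Set Y} {Q : Set X}
    (hQ : Q.Countable)
    (hQW : ∀ x ∈ Q, π x ∈ W)
    (hdis : Q.PairwiseDisjoint fun x => bowenClosedBall (F n) (π x) δ) (f : Y → ℝ) (s : ℝ) :
    ∑' x : Q, ENNReal.ofReal (Real.exp (-s * ((F n).card : ℝ) + orbitSum (F n) f (π x))) ≤
      packingPre F f N s δ W := by
  have hinj : Set.InjOn (fun x => (n, π x)) Q := by
    intro x hx x' hx' h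
    have h' : π x = π x' := congrArg Prod.snd h
    by_contra hne
    refine Set.disjoint_left.1 (hdis hx hx' hne) (mem_bowenClosedBall_self (F n) (π x) hδ) ?_
    rw [h']
    exact mem_bowenClosedBall_self (F n) (π x') hδ
  have hP : IsPacking F N δ W ((fun x => (n, π x)) '' Q) := by
    refine ⟨hQ.image _, ?_, ?_, ?_⟩
    · rintro _ ⟨x, _, rfl⟩; exact hn
    · rintro _ ⟨x, hx, rfl⟩; exact hQW x hx
    · rintro _ ⟨x, hx, rfl⟩ _ ⟨x', hx', rfl⟩ hne
      exact hdis hx hx' fun h => hne (by rw [h])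
  refine le_trans (le_of_eq ?_) (hP.tsum_le_packingPre f s)
  exact (tsum_image (fun p : ℕ × Y => ENNReal.ofReal
    (Real.exp (-s * ((F p.1).card : ℝ) + orbitSum (F p.1) f p.2))) hinj).symm

theorem tsum_subtype_le_mul {α : Type*} {Z : Set α} {w : α → ℝ≥0∞} {K : ℝ} {v : ℝ≥0∞}
    (hcard : ∀ E : Finset α, (E : Set α) ⊆ Z → (E.card : ℝ) ≤ K)
    (hw : ∀ x ∈ Z, w x ≤ v) : ∑' x : Z, w x ≤ ENNReal.ofReal K * v := by
  rw [ENNReal.tsum_eq_iSup_sum]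
  refine iSup_le fun E => (Finset.sum_le_card_nsmul E _ v fun x _ => hw x x.2).trans ?_
  rw [nsmul_eq_mul, ← ENNReal.ofReal_natCast]
  refine mul_le_mul_left (ENNReal.ofReal_le_ofReal ?_) _
  have := hcard (E.map (Function.Embedding.subtype _)) (by simp)
  rwa [Finset.card_map] at this

/-- Thinning out one level of a packing upstairs: a separated set `Z` projects to a family of
centres from which one extracts a disjoint family of balls, at the cost of the factor `K`, the
size of the separated sets lying over a Bowen ball, and of the oscillation `V` of the orbit sums. -/
theorem exists_disjoint_tsum_le [SMul G X] [SMul G Y] {π : X → Y} {A : Finset G} {f : Y → ℝ}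
    {ε δ K V c : ℝ} (hδ : 0 ≤ δ) {Z : Set X}
    (hZ : ∀ x ∈ Z, ∀ x' ∈ Z, x ≠ x' → ε < bowenDist A x x')
    (hcard : ∀ y : Y, ∀ E : Finset X,
      IsSeparatedIn A ε {x | bowenDist A (π x) y ≤ 2 * δ} E → (E.card : ℝ) ≤ K)
    (hvar : ∀ y y' : Y, bowenDist A y y' ≤ 2 * δ → orbitSum A f y ≤ V + orbitSum A f y') :
    ∃ Q ⊆ Z, (Q.PairwiseDisjoint fun x => bowenClosedBall A (π x) δ) ∧
      ∑' x : Z, ENNReal.ofReal (Real.exp (c + orbitSum A f (π x))) ≤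
        ENNReal.ofReal (K * Real.exp V) *
          ∑' x : Q, ENNReal.ofReal (Real.exp (c + orbitSum A f (π x))) := by
  obtain ⟨Q, hQZ, hdis, hcov⟩ := Vitali.exists_disjoint_subfamily_covering_enlargement
    (fun x => bowenClosedBall A (π x) δ) Z (fun _ => 1) 2 one_lt_two (fun _ _ => zero_le_one) 1
    (fun _ _ => le_rfl) fun x _ => ⟨π x, mem_bowenClosedBall_self A (π x) hδ⟩
  refine ⟨Q, hQZ, hdis, ?_⟩
  let P : X → Set X := fun q => {x | x ∈ Z ∧ bowenDist A (π x) (π q) ≤ 2 * δ}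
  have hsub : Z ⊆ ⋃ q : Q, P q := by
    intro x hx
    obtain ⟨q, hq, ⟨y, hy, hy'⟩, _⟩ := hcov x hx
    refine Set.mem_iUnion.2 ⟨⟨q, hq⟩, hx, ?_⟩
    have h1 : bowenDist A (π x) y ≤ δ := hy
    have h2 : bowenDist A (π q) y ≤ δ := hy'
    have h3 := bowenDist_triangle A (π x) y (π q)
    rw [bowenDist_comm A y] at h3
    linarith
  refine (ENNReal.tsum_mono_subtype
    (fun x => ENNReal.ofReal (Real.exp (c + orbitSum A f (π x)))) hsub).trans
    ((ENNReal.tsum_iUnion_le_tsum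
      (fun x => ENNReal.ofReal (Real.exp (c + orbitSum A f (π x)))) fun q : Q => P q).trans ?_)
  rw [← ENNReal.tsum_mul_left]
  refine ENNReal.tsum_le_tsum fun q => ?_
  have hK : 0 ≤ K := by simpa using hcard (π q) ∅ ⟨by simp, by simp⟩
  rw [ENNReal.ofReal_mul hK, mul_assoc]
  refine tsum_subtype_le_mul (Z := P q)
    (w := fun x => ENNReal.ofReal (Real.exp (c + orbitSum A f (π x)))) (fun E hE => hcard (π q) E
    ⟨fun x hx => (hE hx).2, fun x hx x' hx' => hZ x (hE hx).1 x' (hE hx').1⟩) fun x hx => ?_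
  rw [← ENNReal.ofReal_mul (Real.exp_pos _).le, ← Real.exp_add]
  exact ENNReal.ofReal_le_ofReal (Real.exp_le_exp.2 (by linarith [hvar _ _ hx.2]))

theorem tsum_le_tsum_fibers {α β : Type*} (S : Set (α × β)) (w : α × β → ℝ≥0∞) :
    ∑' p : S, w p ≤ ∑' a, ∑' x : {x | (a, x) ∈ S}, w (a, x) := by
  have hsub : S ⊆ ⋃ a, Prod.mk a '' {x | (a, x) ∈ S} := fun p hp =>
    Set.mem_iUnion.2 ⟨p.1, p.2, hp, rfl⟩
  refine (ENNReal.tsum_mono_subtype w hsub).trans ((ENNReal.tsum_iUnion_le_tsum _ _).trans ?_)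
  exact ENNReal.tsum_le_tsum fun a => (tsum_image w (Prod.mk_right_injective a).injOn).le

theorem exists_orbitSum_le_add [SMul G Y] [CompactSpace Y] {f : Y → ℝ} (hf : Continuous f) {τ : ℝ}
    (hτ : 0 < τ) :
    ∃ δ > 0, ∀ (A : Finset G) (y y' : Y), bowenDist A y y' ≤ δ →
      orbitSum A f y ≤ τ * A.card + orbitSum A f y' := by
  obtain ⟨δ, hδ, h⟩ := Metric.uniformContinuous_iff.1
    (CompactSpace.uniformContinuous_of_continuous hf) τ hτ
  refine ⟨δ / 2, half_pos hδ, fun A y y' hyy' => ?_⟩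
  have h1 : ∀ g ∈ A, f (g • y) ≤ τ + f (g • y') := by
    intro g hg
    have := h (((bowenDist_le_iff A y y' (half_pos hδ).le).1 hyy' g hg).trans_lt (half_lt_self hδ))
    rw [Real.dist_eq] at this
    linarith [(abs_lt.1 this).2]
  refine (Finset.sum_le_sum h1).trans (le_of_eq ?_)
  rw [Finset.sum_add_distrib, Finset.sum_const, nsmul_eq_mul, mul_comm, orbitSum]

end Packing

section Growth

variable {G : Type*} {F : ℕ → Finset G}

theorem tendsto_card_atTop
    (hF : Tendsto (fun n : ℕ => ((F n).card : ℝ) / Real.log (n : ℝ)) atTop atTop) :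
    Tendsto (fun n => ((F n).card : ℝ)) atTop atTop := by
  have hlog : Tendsto (fun n : ℕ => Real.log (n : ℝ)) atTop atTop :=
    Real.tendsto_log_atTop.comp tendsto_natCast_atTop_atTop
  refine (hF.atTop_mul_atTop₀ hlog).congr' ?_
  filter_upwards [hlog.eventually_gt_atTop 0] with n hn
  exact div_mul_cancel₀ _ hn.ne'

theorem tsum_exp_neg_mul_card_ne_top
    (hF : Tendsto (fun n : ℕ => ((F n).card : ℝ) / Real.log (n : ℝ)) atTop atTop) {τ : ℝ}
    (hτ : 0 < τ) : ∑' n, ENNReal.ofReal (Real.exp (-τ * (F n).card)) ≠ ∞ := by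
  refine Summable.tsum_ofReal_ne_top ?_
  refine Summable.of_norm_bounded_eventually_nat
    (Real.summable_one_div_nat_pow.2 one_lt_two) ?_
  filter_upwards [hF.eventually_ge_atTop (2 / τ), eventually_gt_atTop 1] with n hn hn1
  have hn1' : (1 : ℝ) < n := by exact_mod_cast hn1
  rw [div_le_div_iff₀ hτ (Real.log_pos hn1')] at hn
  rw [Real.norm_eq_abs, abs_of_pos (Real.exp_pos _), one_div, ← Real.exp_log (by positivity :
    (0 : ℝ) < ((n : ℝ) ^ 2)⁻¹), Real.exp_le_exp, Real.log_inv, Real.log_pow]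
  push_cast
  linarith

end Growth

/-! ### Comparison of the pressures -/

section Upper

variable {G X Y : Type*} [Group G] [MetricSpace X] [MetricSpace Y] [MulAction G X] [MulAction G Y]
  [CompactSpace X] [CompactSpace Y] [ContinuousConstSMul G X]

/-- The loss `3 τ` splits into the error of the fibre entropy, the oscillation of `f`, and the
factor `exp (-τ |F n|)` that makes the sum over the levels `n` converge. -/
theorem exists_packingLim_comp_le {π : X → Y} (hπ : IsFactorMap G π) {F : ℕ → Finset G}
    (hF : IsFolnerSeq F)
    (hFg : Tendsto (fun n : ℕ => ((F n).card : ℝ) / Real.log (n : ℝ)) atTop atTop)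
    {f : Y → ℝ} (hf : Continuous f) {a : ℝ} (ha : 0 ≤ a)
    (hfib : ∀ y, ucEntropy F (π ⁻¹' {y}) ≤ a) {ε τ : ℝ} (hε : 0 < ε) (hτ : 0 < τ) (s : ℝ) :
    ∃ δ > 0, ∃ c : ℝ≥0∞, c ≠ ∞ ∧ ∀ W : Set Y,
      packingLim F (f ∘ π) s ε (π ⁻¹' W) ≤ c * packingLim F f (s - (a + 3 * τ)) δ W := by
  obtain ⟨δ₁, hδ₁, hcard⟩ := exists_eventually_card_separated_le hπ hF ha hfib hε hτ
  obtain ⟨δ₂, hδ₂, hvar⟩ := exists_orbitSum_le_add (G := G) hf hτ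
  obtain ⟨N₁, hN₁⟩ := eventually_atTop.1 hcard
  set δ : ℝ := min δ₁ δ₂ / 2
  have hδ : 0 < δ := half_pos (lt_min hδ₁ hδ₂)
  have h2δ₁ : 2 * δ ≤ δ₁ := (mul_div_cancel₀ _ two_ne_zero).trans_le (min_le_left δ₁ δ₂)
  have h2δ₂ : 2 * δ ≤ δ₂ := (mul_div_cancel₀ _ two_ne_zero).trans_le (min_le_right δ₁ δ₂)
  set c : ℝ≥0∞ := ∑' n, ENNReal.ofReal (Real.exp (-τ * (F n).card))
  have hc : c ≠ ∞ := tsum_exp_neg_mul_card_ne_top hFg hτ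
  refine ⟨δ, hδ, c, hc, fun W => ?_⟩
  have key : ∀ N ≥ N₁, packingPre F (f ∘ π) N s ε (π ⁻¹' W) ≤
      c * packingPre F f N (s - (a + 3 * τ)) δ W := by
    intro N hN
    refine iSup₂_le fun S hS => (tsum_le_tsum_fibers S fun p => ENNReal.ofReal
      (Real.exp (-s * ((F p.1).card : ℝ) + orbitSum (F p.1) (f ∘ π) p.2))).trans ?_
    rw [← ENNReal.tsum_mul_right]
    refine ENNReal.tsum_le_tsum fun n => ?_
    set Z : Set X := {x | (n, x) ∈ S}
    rcases lt_or_ge n N with hn | hn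
    · have hZ : Z = ∅ := Set.eq_empty_of_forall_notMem fun x hx =>
        (hS.le_index _ hx).not_gt hn
      simp [hZ]
    have hsep : ∀ x ∈ Z, ∀ x' ∈ Z, x ≠ x' → ε < bowenDist (F n) x x' := by
      intro x hx x' hx' hne
      by_contra! hle
      exact Set.disjoint_left.1 (hS.disjoint hx hx' fun h => hne (congrArg Prod.snd h))
        (show x' ∈ bowenClosedBall (F n) x ε from hle) (mem_bowenClosedBall_self (F n) x' hε.le)
    obtain ⟨Q, hQZ, hdis, hQ⟩ := exists_disjoint_tsum_le (π := π) (f := f)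
      (c := -s * ((F n).card : ℝ)) hδ.le hsep
      (fun y E hE => hN₁ n (hN.trans hn) y E ⟨fun x hx => (hE.1 hx).trans h2δ₁, hE.2⟩)
      (fun y y' hyy' => hvar (F n) y y' (hyy'.trans h2δ₂))
    have hQc : Q.Countable :=
      (hS.countable.preimage (Prod.mk_right_injective n)).mono hQZ
    have hpre := tsum_le_packingPre_of_pairwiseDisjoint (W := W) hn hδ.le hQc
      (fun x hx => hS.center_mem _ (hQZ hx)) hdis f (s - (a + 3 * τ))
    simp only [orbitSum_comp hπ.map_smul]
    refine hQ.trans (le_trans (le_of_eq ?_) (mul_le_mul_right hpre _))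
    rw [← ENNReal.tsum_mul_left, ← ENNReal.tsum_mul_left]
    refine tsum_congr fun q => ?_
    rw [← Real.exp_add, ← ENNReal.ofReal_mul (Real.exp_pos _).le,
      ← ENNReal.ofReal_mul (Real.exp_pos _).le, ← Real.exp_add, ← Real.exp_add]
    ring_nf
  refine ge_of_tendsto (ENNReal.Tendsto.const_mul
    (tendsto_packingPre F f (s - (a + 3 * τ)) δ W) (Or.inr hc)) ?_
  filter_upwards [eventually_ge_atTop N₁] with N hN
  exact (iInf_le _ N).trans (key N hN)

theorem sub_le_packingPressure_image {π : X → Y} (hπ : IsFactorMap G π) {F : ℕ → Finset G}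
    (hF : IsFolnerSeq F)
    (hFg : Tendsto (fun n : ℕ => ((F n).card : ℝ) / Real.log (n : ℝ)) atTop atTop)
    {f : Y → ℝ} (hf : Continuous f) {a : ℝ} (ha : 0 ≤ a)
    (hfib : ∀ y, ucEntropy F (π ⁻¹' {y}) ≤ a) {ε τ : ℝ} (hε : 0 < ε) (hτ : 0 < τ) {s : ℝ}
    {E : Set X} (hs : packingOuter F (f ∘ π) s ε E = ∞) :
    ((s - (a + 3 * τ) : ℝ) : EReal) ≤ packingPressure F f (π '' E) := by
  obtain ⟨δ, hδ, c, hc, hle⟩ := exists_packingLim_comp_le hπ hF hFg hf ha hfib hε hτ s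
  refine le_iSup₂_of_le δ hδ (le_iSup₂_of_le (s - (a + 3 * τ)) ?_ le_rfl)
  refine iInf₂_eq_top.2 fun W hW => ?_
  by_contra hne
  have hcov : E ⊆ ⋃ i, π ⁻¹' W i := by
    rw [← Set.preimage_iUnion]
    exact Set.image_subset_iff.1 hW
  have h1 : packingOuter F (f ∘ π) s ε E ≤
      c * ∑' i, packingLim F f (s - (a + 3 * τ)) δ (W i) := by
    refine (iInf₂_le (fun i => π ⁻¹' W i) hcov).trans ?_
    rw [← ENNReal.tsum_mul_left]
    exact ENNReal.tsum_le_tsum fun i => hle (W i)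
  rw [hs] at h1
  exact (ENNReal.mul_ne_top hc hne) (top_le_iff.1 h1)

end Upper

theorem packingPressure_image_le {G X Y : Type*} [MetricSpace X] [MetricSpace Y] [SMul G X]
    [SMul G Y] [CompactSpace X] {π : X → Y} (hπ : IsFactorMap G π) (F : ℕ → Finset G) (f : Y → ℝ)
    (E : Set X) : packingPressure F f (π '' E) ≤ packingPressure F (f ∘ π) E := by
  refine iSup₂_le fun ε hε => ?_
  obtain ⟨δ, hδ, hunif⟩ := Metric.uniformContinuous_iff.1
    (CompactSpace.uniformContinuous_of_continuous hπ.continuous) ε hε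
  refine le_iSup₂_of_le (δ / 2) (half_pos hδ) (iSup₂_le fun s hs => le_iSup₂_of_le s ?_ le_rfl)
  refine top_le_iff.1 (hs ▸ ?_)
  refine le_iInf₂ fun W hW => (iInf₂_le (fun i => π '' W i) ?_).trans
    (ENNReal.tsum_le_tsum fun i => iInf_mono fun N => ?_)
  · rw [← Set.image_iUnion]
    exact Set.image_mono hW
  -- a packing downstairs lifts, centre by centre, to a packing upstairs
  refine iSup₂_le fun S hS => ?_
  have hlift : ∀ p : ℕ × Y, p ∈ S → ∃ x, x ∈ W i ∧ π x = p.2 := hS.center_mem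
  rcases isEmpty_or_nonempty X with hX | hX
  · have : S = ∅ := Set.eq_empty_of_forall_notMem fun p hp => hX.elim (hlift p hp).choose
    simp [this]
  choose! σ hσW hσ' using hlift
  have hinj : Set.InjOn (fun p : ℕ × Y => (p.1, σ p)) S := by
    intro p hp q hq hpq
    obtain ⟨h1, h2⟩ : p.1 = q.1 ∧ σ p = σ q := Prod.mk.injEq _ _ _ _ ▸ hpq
    exact Prod.ext h1 (by rw [← hσ' p hp, ← hσ' q hq, h2])
  have hP : IsPacking F N (δ / 2) (W i) ((fun p => (p.1, σ p)) '' S) := by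
    refine ⟨hS.countable.image _, ?_, ?_, ?_⟩
    · rintro _ ⟨p, hp, rfl⟩; exact hS.le_index p hp
    · rintro _ ⟨p, hp, rfl⟩; exact hσW p hp
    · rintro _ ⟨p, hp, rfl⟩ _ ⟨q, hq, rfl⟩ hne
      have hball : ∀ p ∈ S, ∀ x, x ∈ bowenClosedBall (F p.1) (σ p) (δ / 2) →
          π x ∈ bowenClosedBall (F p.1) p.2 ε := by
        intro p hp x hx
        refine (bowenDist_le_iff _ _ _ hε.le).2 fun g hg => ?_
        rw [← hσ' p hp, ← hπ.map_smul, ← hπ.map_smul]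
        exact (hunif (((bowenDist_le_iff _ _ _ (half_pos hδ).le).1 hx g hg).trans_lt
          (half_lt_self hδ))).le
      refine Set.disjoint_left.2 fun x hx hx' => ?_
      exact Set.disjoint_left.1 (hS.disjoint hp hq fun h => hne (by rw [h]))
        (hball p hp x hx) (hball q hq x hx')
  refine le_trans (le_of_eq ?_) (hP.tsum_le_packingPre (f ∘ π) s)
  refine Eq.trans (tsum_congr fun p => ?_) (tsum_image (fun p : ℕ × X => ENNReal.ofReal
    (Real.exp (-s * ((F p.1).card : ℝ) + orbitSum (F p.1) (f ∘ π) p.2))) hinj).symm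
  rw [orbitSum_comp hπ.map_smul, hσ' p.1 p.2]

theorem packingPressure_empty {G X : Type*} [MetricSpace X] [SMul G X] (F : ℕ → Finset G)
    (f : X → ℝ) : packingPressure F f (∅ : Set X) = ⊥ := by
  refine eq_bot_iff.2 (iSup₂_le fun ε _ => iSup₂_le fun s hs => ?_)
  exfalso
  have h0 : packingLim F f s ε ∅ = 0 := by
    refine le_antisymm ((iInf_le _ 0).trans (iSup₂_le fun S hS => ?_)) zero_le
    have : S = ∅ := Set.eq_empty_of_forall_notMem fun p hp => hS.center_mem p hp
    simp [this]
  have h1 : packingOuter F f s ε ∅ ≤ 0 :=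
    (iInf₂_le (fun _ => (∅ : Set X)) (Set.empty_subset _)).trans (by simp [h0])
  rw [hs] at h1
  exact absurd h1 (by simp)

/-- On a non-empty set the packing pressure is bounded below by a bound of `f`: already one ball
for each large `n` gives infinite packing sums. -/
theorem packingPressure_ne_bot {G X : Type*} [MetricSpace X] [SMul G X] {F : ℕ → Finset G}
    (hF : Tendsto (fun n => ((F n).card : ℝ)) atTop atTop) {f : X → ℝ} {B : ℝ}
    (hf : ∀ x, B ≤ f x) {Z : Set X} (hZ : Z.Nonempty) : packingPressure F f Z ≠ ⊥ := by
  have h : ((B - 1 : ℝ) : EReal) ≤ packingPressure F f Z := by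
    refine le_iSup₂_of_le 1 one_pos (le_iSup₂_of_le (B - 1) ?_ le_rfl)
    refine iInf₂_eq_top.2 fun W hW => ?_
    obtain ⟨z, hz⟩ := hZ
    obtain ⟨i, hi⟩ := Set.mem_iUnion.1 (hW hz)
    refine ENNReal.tsum_eq_top_of_eq_top ⟨i, iInf_eq_top.2 fun N => ?_⟩
    have hlim : Tendsto (fun n => ENNReal.ofReal (Real.exp ((F n).card))) atTop (𝓝 ∞) :=
      ENNReal.tendsto_ofReal_atTop.comp (Real.tendsto_exp_atTop.comp hF)
    refine top_le_iff.1 (le_of_tendsto hlim ?_)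
    filter_upwards [eventually_ge_atTop N] with n hn
    have hP : IsPacking F N 1 (W i) {(n, z)} := by
      refine ⟨Set.countable_singleton _, ?_, ?_, Set.pairwiseDisjoint_singleton _ _⟩
      · rintro _ rfl; exact hn
      · rintro _ rfl; exact hi
    refine le_trans ?_ (hP.tsum_le_packingPre f (B - 1))
    rw [tsum_singleton (n, z) (fun p : ℕ × X => ENNReal.ofReal
      (Real.exp (-(B - 1) * ((F p.1).card : ℝ) + orbitSum (F p.1) f p.2)))]
    refine ENNReal.ofReal_le_ofReal (Real.exp_le_exp.2 ?_)
    have : (F n).card • B ≤ orbitSum (F n) f z :=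
      Finset.card_nsmul_le_sum _ _ _ fun g _ => hf (g • z)
    rw [nsmul_eq_mul] at this
    linarith
  exact fun hbot => EReal.coe_ne_bot _ (le_bot_iff.1 (hbot ▸ h))

theorem ucEntropy_nonneg {G X : Type*} [MetricSpace X] [SMul G X] (F : ℕ → Finset G) {Z : Set X}
    (hZ : Z.Nonempty) : 0 ≤ ucEntropy F Z := by
  refine le_iSup₂_of_le 1 one_pos (le_limsup_of_frequently_le (Frequently.of_forall fun n => ?_))
  obtain ⟨z, hz⟩ := hZ
  refine EReal.div_nonneg ?_ (by positivity)
  rw [← ENNReal.log_one, ENNReal.log_le_log_iff]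
  refine le_iSup₂_of_le {z} ⟨by simpa using hz, ?_⟩ ?_
  · rintro x rfl y rfl h
    exact absurd rfl h
  · rw [tsum_singleton z (fun x : X => ENNReal.ofReal (Real.exp (orbitSum (F n) (fun _ => 0) x)))]
    simp [orbitSum]

end AmenablePressure
end

open AmenablePressure in
theorem theorem1p2 {G X Y : Type*} [Group G] [Countable G] [Infinite G]
    [MetricSpace X] [CompactSpace X] [MulAction G X] [ContinuousConstSMul G X]
    [MetricSpace Y] [CompactSpace Y] [MulAction G Y] [ContinuousConstSMul G Y]
    (π : X → Y) (hπ : IsFactorMap G π)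
    (F : ℕ → Finset G) (hF : IsFolnerSeq F) (hFt : IsTempered F)
    (hFg : Tendsto (fun n : ℕ => ((F n).card : ℝ) / Real.log (n : ℝ)) atTop atTop)
    (E : Set X) (f : C(Y, ℝ)) :
    packingPressure F f (π '' E) ≤ packingPressure F (f ∘ π) E ∧
      packingPressure F (f ∘ π) E ≤
        packingPressure F f (π '' E) + ⨆ y : Y, ucEntropy F (π ⁻¹' {y}) := by
  refine ⟨packingPressure_image_le hπ F f E, ?_⟩
  rcases E.eq_empty_or_nonempty with rfl | hE
  · rw [packingPressure_empty]
    exact bot_le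
  obtain ⟨x₀, hx₀⟩ := hE
  have hfib := le_iSup fun y : Y => ucEntropy F (π ⁻¹' {y})
  have ha : 0 ≤ ⨆ y : Y, ucEntropy F (π ⁻¹' {y}) :=
    (ucEntropy_nonneg F (Z := π ⁻¹' {π x₀}) ⟨x₀, rfl⟩).trans (hfib (π x₀))
  generalize (⨆ y : Y, ucEntropy F (π ⁻¹' {y})) = a at hfib ha ⊢
  induction a with
  | bot => exact absurd ha (by simp)
  | top =>
    obtain ⟨B, hB⟩ := (isCompact_range f.continuous).bddBelow
    rw [EReal.add_top_of_ne_bot (packingPressure_ne_bot (tendsto_card_atTop hFg)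
      (fun y => hB ⟨y, rfl⟩) (Set.Nonempty.image π ⟨x₀, hx₀⟩))]
    exact le_top
  | coe a =>
    refine iSup₂_le fun ε hε => iSup₂_le fun s hs => ?_
    have key : ∀ τ > 0, ((s - (a + 3 * τ) : ℝ) : EReal) ≤ packingPressure F f (π '' E) :=
      fun τ hτ => sub_le_packingPressure_image hπ hF hFg f.continuous (by exact_mod_cast ha)
        hfib hε hτ hs
    generalize packingPressure F f (π '' E) = p at key ⊢
    induction p with
    | bot => exact absurd (key 1 one_pos) (by simp only [le_bot_iff]; exact EReal.coe_ne_bot _)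
    | top => rw [EReal.top_add_coe]; exact le_top
    | coe p =>
      rw [← EReal.coe_add, EReal.coe_le_coe_iff]
      refine le_of_forall_pos_le_add fun η hη => ?_
      have := EReal.coe_le_coe_iff.1 (key (η / 3) (by positivity))
      linarith
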